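/- A network $N$ is a finite set of cells $C$ with maps $\sigma_1,\dots,\sigma_k:C\to C$; there is an edge of type $i$ from $\sigma_i(c)$ to $c$. It is a feed-forward network with layers $C_0,\dots,C_m$ if these nonempty sets partition $C$, $\sigma_i(c)=c$ for $c\in C_0$, $\sigma_i(C_j)\subseteq C_{j-1}$ for $1\le j\le m$, and each $c\in C_j$ with $j<m$ is $\sigma_i(c')$ for some $i$ and some $c'\in C_{j+1}$. It is backward connected if, for some cell $c$, there is a directed path from every other cell to $c$. An equivalence relation $\bowtie$ on the cells is balanced if $c\bowtie c'$ implies $\sigma_i(c)\bowtie\sigma_i(c')$ for all $i$; then the quotient network $N/{\bowtie}$ is defined. A network $L$ is a lift of $N$ if $L/{\bowtie}=N$ (up to relabelling the cells) for some balanced $\bowtie$. If $N$ and $L$ are feed-forward, $L$ is a lift inside the layer $C_j$ if moreover both have the same number of layers and their layers of the same index have equally many cells, except for the $j$-th layers, whose cardinalities differ. For $f=f(x_0,x_1,\dots,x_k,\lambda)$ let $(f^N(x,\lambda))_c=f(x_c,x_{\sigma_1(c)},\dots,x_{\sigma_k(c)},\lambda)$. Subscripts of $f$ denote partial derivatives at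 the origin. Let $\mathcal V_0(N)$ be the set of smooth $f:\mathbb R^{k+1}\times\mathbb R\to\mathbb R$ with $f(0,\dots,0,\lambda)=0$ for all $\lambda$ and $f_0=0$. A branch is a function $b:D\to\mathbb R^{C}$ where $D$ is $]-\rho,\rho[$, $[0,\rho[$ or $]-\rho,0]$ for some $\rho>0$; in the first case $b$ is smooth, in the other two cases each $b_c(\lambda)$ is, for some integer $p\ge0$, a smooth function of $|\lambda|^{2^{-p}}$ on $[0,\rho^{2^{-p}}[$. Germ equivalence of branches is the equivalence relation generated by: $b_1:D_1\to\mathbb R^C$ and $b_2:D_2\to\mathbb R^C$ agree on $U\cap D_1\cap D_2\neq\{0\}$ for some open neighbourhood $U$ of $0$. An equilibrium branch of $f$ on $N$ is a branch $b$ with $b(0)=0$ and $f^N(b(\lambda),\lambda)=0$ for all $\lambda\in D$; it is a bifurcation branch if it is not germ equivalent to the branch $0$. A bifurcation branch $b$ of $f$ on $L$ is lifted from $N$ if there are a balanced $\bowtie$ on $L$ with $L/{\bowtie}=N$ and a branch $b'$ germ equivalent to $b$ such that, for every $\lambda$ in the domain of $b'$, $b'_c(\lambda)=b'_d(\lambda)$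 whenever $c\bowtie d$. **Proposition.** Let $N$ be a feed-forward network with layers $C_0,\dots,C_m$ and let $L$ be a backward connected feed-forward network that is a lift of $N$ inside the layer $C_j$, where $0<j<m-1$. The set $\mathcal G$ of those $f\in\mathcal V_0(N)$ with $f_{00}\ne0$ and $f_{0\lambda}\neq0$ is open and dense in $\mathcal V_0(N)$ for the topology of uniform convergence of all derivatives on compact sets, and for every $f\in\mathcal G$: if $f_i>0$ for every $1\le i\le k$, or $f_i<0$ for every $1\le i\le k$, then there is a bifurcation branch of $f$ on $L$ which is not lifted from $N$. -/

import Mathlib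

open scoped ContDiff

/-- A network with set of cells `C` and edge types `1, …, k` in which every cell is the target of
exactly one edge of each type: `σ i c` is the source of the edge of type `i` targeting `c`. -/
structure Network (k : ℕ) (C : Type*) where
  σ : Fin k → C → C

namespace Network

variable {k : ℕ} {C C' : Type*}

/-- There is an edge from `a` to `b`. -/
def Edge (N : Network k C) (a b : C) : Prop := ∃ i, a = N.σ i b

/-- Two networks are equal (up to a relabelling of the cells). -/
def Same (N : Network k C) (N' : Network k C') : Prop :=
  ∃ φ : C ≃ C', ∀ i c, φ (N.σ i c) = N'.σ i (φ c)

/-- `N` is a feed-forward network with layers `C_0, …, C_m`, where `C_j = {c | layer c = j}`. -/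
structure IsFeedForward (N : Network k C) (m : ℕ) (layer : C → ℕ) : Prop where
  layer_le : ∀ c, layer c ≤ m
  layer_nonempty : ∀ j ≤ m, ∃ c, layer c = j
  first : ∀ c, layer c = 0 → ∀ i, N.σ i c = c
  next : ∀ c, layer c ≠ 0 → ∀ i, layer (N.σ i c) + 1 = layer c
  source : ∀ c, layer c < m → ∃ c' i, layer c' = layer c + 1 ∧ c = N.σ i c'

/-- The number of cells in the `j`-th layer. -/
noncomputable def layerCard (layer : C → ℕ) (j : ℕ) : ℕ := {c | layer c = j}.ncard

/-- From every other cell there is a directed path to `c`. -/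
def BackwardConnectedFor (N : Network k C) (c : C) : Prop :=
  ∀ c', c' ≠ c → Relation.TransGen N.Edge c' c

def BackwardConnected (N : Network k C) : Prop := ∃ c, N.BackwardConnectedFor c

/-- A coloring (an equivalence relation on the cells) is balanced. -/
def Balanced (N : Network k C) (r : Setoid C) : Prop :=
  ∀ i c c', r c c' → r (N.σ i c) (N.σ i c')

/-- The quotient network associated to a balanced coloring. -/
def quotient (N : Network k C) (r : Setoid C) (h : N.Balanced r) : Network k (Quotient r) where
  σ i := Quotient.map (N.σ i) (fun a b hab => h i a b hab)

/-- The coloring `r` of `L` is balanced and `N = L / r`. -/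
def IsQuotientBy (N : Network k C) (L : Network k C') (r : Setoid C') : Prop :=
  ∃ h : L.Balanced r, (L.quotient r h).Same N

/-- `L` is a lift of `N`. -/
def IsLift (N : Network k C) (L : Network k C') : Prop := ∃ r, N.IsQuotientBy L r

/-- For feed-forward networks `N` (layers `C_0, …, C_m`) and `L` (layers `C'_0, …, C'_n`):
`L` is a lift of `N` inside the layer `C_j`. -/
structure IsLiftInsideLayer (N : Network k C) (m : ℕ) (layer : C → ℕ)
    (L : Network k C') (n : ℕ) (layer' : C' → ℕ) (j : ℕ) : Prop where
  isLift : N.IsLift L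
  le : j ≤ m
  length_eq : m = n
  card_ne : layerCard layer' j ≠ layerCard layer j
  card_eq : ∀ i ≤ m, i ≠ j → layerCard layer' i = layerCard layer i

/-- The polydiagonal subspace of a coloring. -/
def polydiagonal (r : Setoid C) : Set (C → ℝ) := {x | ∀ c d, r c d → x c = x d}

/-- The admissible vector field `f^N(·, t)` of the family
`f (x, (x_1, …, x_k), t)` with parameter `t`. -/
def vectorField (N : Network k C) (f : ℝ × (Fin k → ℝ) × ℝ → ℝ) (x : C → ℝ) (t : ℝ) : C → ℝ :=
  fun c => f (x c, fun i => x (N.σ i c), t)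

end Network

namespace FeedForward

/-- The arguments of `f` are the internal state, the `k` inputs and the parameter. -/
abbrev Response (k : ℕ) : Type := ℝ × (Fin k → ℝ) × ℝ → ℝ

variable {k : ℕ} {C C' : Type*}

/-- The first derivative at the origin with respect to the internal state. -/
noncomputable def d0 (f : Response k) : ℝ := deriv (fun x => f (x, 0, 0)) 0

/-- The first derivative at the origin with respect to the `i`-th input. -/
noncomputable def dInput (f : Response k) (i : Fin k) : ℝ :=
  deriv (fun x => f (0, Pi.single i x, 0)) 0

/-- The second derivative at the origin with respect to the internal state. -/
noncomputable def d00 (f : Response k) : ℝ := iteratedDeriv 2 (fun x => f (x, 0, 0)) 0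

/-- The mixed derivative at the origin with respect to the internal state and the parameter. -/
noncomputable def d0par (f : Response k) : ℝ :=
  deriv (fun t => deriv (fun x => f (x, 0, t)) 0) 0

/-- Smooth families with a fully synchronous equilibrium at the origin for every parameter. -/
def V (k : ℕ) : Set (Response k) := {f | ContDiff ℝ ∞ f ∧ ∀ t, f (0, 0, t) = 0}

/-- The bifurcation condition associated with the internal dynamics. -/
def V0 (k : ℕ) : Set (Response k) := {f | f ∈ V k ∧ d0 f = 0}

/-- The nondegenerate elements of `V0 k`. -/
def V0gen (k : ℕ) : Set (Response k) := {f | f ∈ V0 k ∧ d00 f ≠ 0 ∧ d0par f ≠ 0}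

/-- `g` is `ε`-close to `f` on `K` together with the derivatives up to order `r`: the basic
neighbourhoods of the topology of uniform convergence of all derivatives on compact sets. -/
def CloseOn (K : Set (ℝ × (Fin k → ℝ) × ℝ)) (r : ℕ) (ε : ℝ) (f g : Response k) : Prop :=
  ∀ i ≤ r, ∀ z ∈ K, ‖iteratedFDeriv ℝ i (g - f) z‖ < ε

/-- `G` is an open dense subset of `W` in the smooth topology. -/
structure OpenDenseIn (W G : Set (Response k)) : Prop where
  subset : G ⊆ W
  isOpen : ∀ f ∈ G, ∃ K r, ∃ ε > 0, IsCompact K ∧ ∀ g ∈ W, CloseOn K r ε f g → g ∈ G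
  dense : ∀ f ∈ W, ∀ K r, ∀ ε > 0, IsCompact K → ∃ g ∈ G, CloseOn K r ε f g

/-- A function `b : D → ℝ^C` on a domain `D`, of one of the forms `]-ρ, ρ[`, `[0, ρ[`, `]-ρ, 0]`.
On `]-ρ, ρ[` it is smooth. On the one-sided domains every component is a smooth
function, up to the end point `0`, of `|t| ^ (2 ^ (-p))` for some `p`
(the branches of positive square-root-order are not differentiable at `0`). -/
structure Branch (C : Type*) where
  dom : Set ℝ
  toFun : ℝ → C → ℝ
  regular :
    (∃ ρ > 0, dom = Set.Ioo (-ρ) ρ ∧ ∀ c, ContDiffOn ℝ ∞ (fun t => toFun t c) dom) ∨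
    (∃ ρ > 0, (dom = Set.Ico 0 ρ ∨ dom = Set.Ioc (-ρ) 0) ∧
      ∀ c, ∃ (p : ℕ) (β : ℝ → ℝ),
        ContDiffOn ℝ ∞ β (Set.Ico 0 (ρ ^ ((2 : ℝ) ^ p)⁻¹)) ∧
        ∀ t ∈ dom, toFun t c = β (|t| ^ ((2 : ℝ) ^ p)⁻¹))

/-- Agreement near `0` on the common domain, which has to be larger than `{0}`. -/
def Branch.Agree (b₁ b₂ : Branch C) : Prop :=
  ∃ U : Set ℝ, IsOpen U ∧ 0 ∈ U ∧ U ∩ b₁.dom ∩ b₂.dom ≠ {0} ∧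
    ∀ t ∈ U ∩ b₁.dom ∩ b₂.dom, b₁.toFun t = b₂.toFun t

/-- Germ equivalence: the equivalence relation generated by `Agree`. -/
def Branch.GermEquiv : Branch C → Branch C → Prop := Relation.EqvGen Branch.Agree

/-- The trivial branch. -/
def Branch.trivial (C : Type*) : Branch C where
  dom := Set.Ioo (-1) 1
  toFun := 0
  regular := Or.inl ⟨1, one_pos, rfl, fun _ => contDiffOn_const⟩

/-- `b` is a branch of equilibria of `f` on `N` emanating from the origin at parameter `0`. -/
def IsEquilibriumBranch (N : Network k C) (f : Response k) (b : Branch C) : Prop :=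
  b.toFun 0 = 0 ∧ ∀ t ∈ b.dom, N.vectorField f (b.toFun t) t = 0

/-- An equilibrium branch whose germ is not that of the trivial branch. -/
def IsBifurcationBranch (N : Network k C) (f : Response k) (b : Branch C) : Prop :=
  IsEquilibriumBranch N f b ∧ ¬ b.GermEquiv (Branch.trivial C)

/-- The germ of the branch `b` on `L` is lifted from `N`: for some balanced coloring `r` of `L`
with `N = L / r`, it has a representative with values in the polydiagonal of `r`. -/
def IsLiftedFrom (N : Network k C) (L : Network k C') (b : Branch C') : Prop :=
  ∃ r : Setoid C', N.IsQuotientBy L r ∧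
    ∃ b' : Branch C', b.GermEquiv b' ∧ ∀ t ∈ b'.dom, b'.toFun t ∈ Network.polydiagonal r

end FeedForward

/-! The argument has a combinatorial and an analytic half. In a backward connected feed-forward
network the last layer is a single cell and every cell is an iterated input of it. A quotient map
from `L` onto `N` must send this cell to the last cell of `N`, and it commutes with all `σ i`, so it
is unique and preserves layers. Since the `j`-th layers have different cardinalities, it identifies
two distinct cells `c`, `d` of layer `j`, and every balanced coloring with quotient `N` then
identifies this same pair (`exists_ne_forall_isQuotientBy`).

It remains to find an equilibrium branch separating `c` and `d`. Put `λ = ε s ^ 2 ^ m`. All cells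
below layer `j`, and `d`, stay at zero, while the other cells of layer `j` follow the nonzero root
`x ≈ -2 (f_{0λ} / f_{00}) λ` of the equation with zero inputs. In later layers, a cell whose inputs
have leading order `s ^ 2 ^ (r + 1)` follows a square-root solution of order `s ^ 2 ^ r`. All
nonzero leading coefficients are kept of one sign `η`; as the `f_i` have a common sign, inputs never
cancel and the square roots stay real (`V0gen.exists_solution`, `exists_layerwise_solution`). Each
layer halves the exponent at most once, so the exponent `2 ^ m` suffices to keep everything smooth
in `s`.

On this branch `b_c - b_d` is of exact order `λ`. Whether such a difference is `o(λ)` is invariant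
under germ equivalence (`Branch.GermEquiv.isLittleO_iff`), even when a chain of representatives
crosses from one side of `0` to the other. Hence the branch is neither trivial nor lifted. -/

/-! ### Parametric integrals, Hadamard's lemma and the implicit function theorem -/

open Filter Topology MeasureTheory Set in
theorem hasFDerivAt_intervalIntegral_of_contDiff {E F : Type} [NormedAddCommGroup E]
    [NormedSpace ℝ E] [FiniteDimensional ℝ E] [NormedAddCommGroup F] [NormedSpace ℝ F]
    [CompleteSpace F] {g : E × ℝ → F} (hg : ContDiff ℝ 1 g) (x₀ : E) :
    HasFDerivAt (fun x => ∫ θ in (0 : ℝ)..1, g (x, θ))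
      (∫ θ in (0 : ℝ)..1, (fderiv ℝ g (x₀, θ)).comp (.inl ℝ E ℝ)) x₀ := by
  have : ProperSpace E := FiniteDimensional.proper ℝ E
  have hc : Continuous fun z : E × ℝ => (fderiv ℝ g z).comp (.inl ℝ E ℝ) :=
    (hg.continuous_fderiv one_ne_zero).clm_comp continuous_const
  obtain ⟨B, hB⟩ := ((isCompact_closedBall x₀ 1).prod (isCompact_Icc (a := (0 : ℝ)) (b := 1))
    ).exists_bound_of_continuousOn hc.continuousOn
  refine intervalIntegral.hasFDerivAt_integral_of_dominated_of_fderiv_le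
    (F := fun x θ => g (x, θ)) (F' := fun x θ => (fderiv ℝ g (x, θ)).comp (.inl ℝ E ℝ))
    (bound := fun _ => B)
    (Metric.closedBall_mem_nhds x₀ one_pos) ?_ ?_ ?_ ?_ ?_ ?_
  · exact Eventually.of_forall fun x =>
      (hg.continuous.comp (by fun_prop : Continuous fun θ : ℝ => (x, θ))).aestronglyMeasurable
  · exact (hg.continuous.comp (by fun_prop : Continuous fun θ : ℝ => (x₀, θ))).intervalIntegrable _ _
  · exact (hc.comp (by fun_prop : Continuous fun θ : ℝ => (x₀, θ))).aestronglyMeasurable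
  · refine Eventually.of_forall fun θ hθ x hx => hB (x, θ) ⟨hx, ?_⟩
    rw [uIoc_of_le zero_le_one] at hθ
    exact Ioc_subset_Icc_self hθ
  · exact intervalIntegrable_const
  · refine Eventually.of_forall fun θ _ x _ => ?_
    exact ((hg.differentiable one_ne_zero) (x, θ)).hasFDerivAt.comp x (hasFDerivAt_prodMk_left x θ)

/-- Differentiation under the integral sign lowers the order by one. The target `F` varies in the
induction because the derivative takes values in a space of linear maps. -/
theorem contDiff_nat_intervalIntegral {E : Type} [NormedAddCommGroup E] [NormedSpace ℝ E]
    [FiniteDimensional ℝ E] (n : ℕ) : ∀ {F : Type} [NormedAddCommGroup F] [NormedSpace ℝ F]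
    [CompleteSpace F] {g : E × ℝ → F}, ContDiff ℝ n g →
    ContDiff ℝ n fun x => ∫ θ in (0 : ℝ)..1, g (x, θ) := by
  induction n with
  | zero =>
    intro F _ _ _ g hg
    rw [Nat.cast_zero, contDiff_zero] at hg ⊢
    exact intervalIntegral.continuous_parametric_intervalIntegral_of_continuous' (f := fun x θ => g (x, θ)) hg 0 1
  | succ n ih =>
    intro F _ _ _ g hg
    have hd := hasFDerivAt_intervalIntegral_of_contDiff (hg.of_le (by norm_cast; omega))
    rw [Nat.cast_succ] at hg ⊢
    rw [contDiff_succ_iff_fderiv]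
    refine ⟨fun x => (hd x).differentiableAt, by simp, ?_⟩
    rw [funext fun x => (hd x).fderiv]
    exact ih (((contDiff_succ_iff_fderiv.1 hg).2.2).clm_comp contDiff_const)

theorem contDiff_intervalIntegral {E F : Type} [NormedAddCommGroup E] [NormedSpace ℝ E]
    [FiniteDimensional ℝ E] [NormedAddCommGroup F] [NormedSpace ℝ F] [CompleteSpace F]
    {g : E × ℝ → F} (hg : ContDiff ℝ ∞ g) :
    ContDiff ℝ ∞ fun x => ∫ θ in (0 : ℝ)..1, g (x, θ) :=
  contDiff_infty.2 fun n => contDiff_nat_intervalIntegral n (contDiff_infty.1 hg n)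

/-- Hadamard's lemma with parameters. -/
theorem ContDiff.exists_eq_add_clm_apply {E P : Type} [NormedAddCommGroup E] [NormedSpace ℝ E]
    [FiniteDimensional ℝ E] [NormedAddCommGroup P] [NormedSpace ℝ P] [FiniteDimensional ℝ P]
    {f : E × P → ℝ} (hf : ContDiff ℝ ∞ f) :
    ∃ ψ : E × P → (E →L[ℝ] ℝ), ContDiff ℝ ∞ ψ ∧ ∀ y p, f (y, p) = f (0, p) + ψ (y, p) y := by
  have hd : ContDiff ℝ ∞ fun z : E × P => (fderiv ℝ f z).comp (.inl ℝ E P) :=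
    (contDiff_infty_iff_fderiv.1 hf).2.clm_comp contDiff_const
  have hg : ContDiff ℝ ∞ fun q : (E × P) × ℝ =>
      (fderiv ℝ f (q.2 • q.1.1, q.1.2)).comp (.inl ℝ E P) :=
    hd.comp (by fun_prop : ContDiff ℝ ∞ fun q : (E × P) × ℝ => (q.2 • q.1.1, q.1.2))
  -- The witness is the integral over `θ ∈ [0, 1]` of the partial derivative in `y` at `(θ • y, p)`.
  refine ⟨_, contDiff_intervalIntegral hg, fun y p => ?_⟩
  have hcont : Continuous fun θ : ℝ => (fderiv ℝ f (θ • y, p)).comp (.inl ℝ E P) :=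
    hg.continuous.comp (by fun_prop : Continuous fun θ : ℝ => ((y, p), θ))
  have h := intervalIntegral.integral_eq_sub_of_hasDerivAt (a := 0) (b := 1)
    (f := fun θ : ℝ => f (θ • y, p))
    (f' := fun θ => (fderiv ℝ f (θ • y, p)).comp (.inl ℝ E P) y) (fun θ _ => ?_)
    ((hcont.clm_apply continuous_const).intervalIntegrable _ _)
  · rw [ContinuousLinearMap.intervalIntegral_apply (hcont.intervalIntegrable _ _), h]
    simp
  · have h1 : HasDerivAt (fun θ : ℝ => (θ • y, p)) (y, 0) θ := by
      simpa using ((hasDerivAt_id θ).smul_const y).prodMk (hasDerivAt_const θ p)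
    exact ((hf.differentiable (by simp)) _).hasFDerivAt.comp_hasDerivAt θ h1

open Filter Topology in
/-- The scalar implicit function theorem for smooth functions, with a solution which is smooth
near the base point. -/
theorem ContDiff.exists_implicit {G : ℝ × ℝ → ℝ} {w₀ G' : ℝ}
    (hG : ∀ᶠ z in 𝓝 ((0 : ℝ), w₀), ContDiffAt ℝ ∞ G z)
    (h0 : G (0, w₀) = 0) (hd : HasDerivAt (fun w => G (0, w)) G' w₀) (hG' : G' ≠ 0) :
    ∃ w : ℝ → ℝ, w 0 = w₀ ∧ (∀ᶠ s in 𝓝 0, ContDiffAt ℝ ∞ w s) ∧ ∀ᶠ s in 𝓝 0, G (s, w s) = 0 := by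
  have hinv : ∀ A : ℝ →L[ℝ] ℝ, A 1 ≠ 0 → A.IsInvertible := fun A hA =>
    ⟨ContinuousLinearEquiv.unitsEquivAut ℝ (Units.mk0 _ hA), by ext; simp⟩
  have hat := hG.self_of_nhds
  have hinf : (∞ : WithTop ℕ∞) ≠ 0 := by simp
  have hfd : (fderiv ℝ G (0, w₀)) (0, 1) = G' := by
    have h1 : HasDerivAt (fun w : ℝ => ((0 : ℝ), w)) (0, 1) w₀ :=
      (hasDerivAt_const w₀ (0 : ℝ)).prodMk (hasDerivAt_id w₀)
    exact (((hat.differentiableAt hinf).hasFDerivAt).comp_hasDerivAt w₀ h1).unique hd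
  have hcont : ContinuousAt (fun z => fderiv ℝ G z (0, 1)) (0, w₀) :=
    ((hat.fderiv_right (m := 0) (by simp)).continuousAt).clm_apply continuousAt_const
  have hne : ∀ᶠ z in 𝓝 ((0 : ℝ), w₀), fderiv ℝ G z (0, 1) ≠ 0 :=
    hcont.eventually_ne (by rw [hfd]; exact hG')
  have hI : ∀ {z}, fderiv ℝ G z (0, 1) ≠ 0 →
      (fderiv ℝ G z ∘L .inr ℝ ℝ ℝ).IsInvertible := fun hz => hinv _ (by simpa using hz)
  have i0 := hI hne.self_of_nhds
  set w := hat.implicitFunction hinf i0 with hw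
  have hw0 : w 0 = w₀ := hat.implicitFunction_apply_self hinf i0
  have hev : ∀ᶠ s in 𝓝 (0 : ℝ), G (s, w s) = 0 := by
    simpa [h0] using hat.eventually_apply_implicitFunction hinf i0
  have hwc : ∀ᶠ s in 𝓝 (0 : ℝ), ContinuousAt w s := by
    have h1 : ContDiffAt ℝ 1 w 0 :=
      (hat.contDiffAt_implicitFunction hinf i0).of_le (by simp)
    exact (h1.eventually (by simp)).mono fun s hs => hs.continuousAt
  have ht : Tendsto (fun s => (s, w s)) (𝓝 0) (𝓝 ((0 : ℝ), w₀)) := by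
    have := hwc.self_of_nhds
    rw [ContinuousAt, hw0] at this
    exact tendsto_id.prodMk_nhds this
  refine ⟨w, hw0, ?_, hev⟩
  -- `ContDiffAt ℝ ∞ w 0` only gives neighbourhoods that depend on the order. Smoothness at each
  -- nearby `s` comes from the implicit function based at `(s, w s)`, which agrees with `w` near `s`
  -- by local uniqueness.
  have hu := (hat.eventually_apply_eq_iff_implicitFunction hinf i0).eventually_nhds
  rw [h0] at hu
  filter_upwards [ht.eventually hG, ht.eventually hne, ht.eventually hu, hev, hwc]
    with s h1 h2 h3 h4 h5
  have i1 := hI h2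
  refine (h1.contDiffAt_implicitFunction hinf i1).congr_of_eventuallyEq ?_
  have hc : ContinuousAt (h1.implicitFunction hinf i1) s :=
    (h1.contDiffAt_implicitFunction hinf i1).continuousAt
  have ht' : Tendsto (fun s' => (s', h1.implicitFunction hinf i1 s')) (𝓝 s) (𝓝 (s, w s)) := by
    have h6 : h1.implicitFunction hinf i1 s = w s := h1.implicitFunction_apply_self hinf i1
    rw [ContinuousAt, h6] at hc
    exact tendsto_id.prodMk_nhds hc
  filter_upwards [ht'.eventually h3, h1.eventually_apply_implicitFunction hinf i1] with s' h7 h8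
  exact h7.1 (h8.trans h4)

theorem ContDiff.exists_eq_add_mul {P : Type} [NormedAddCommGroup P] [NormedSpace ℝ P]
    [FiniteDimensional ℝ P] {f : ℝ × P → ℝ} (hf : ContDiff ℝ ∞ f) :
    ∃ ψ : ℝ × P → ℝ, ContDiff ℝ ∞ ψ ∧ ∀ x p, f (x, p) = f (0, p) + x * ψ (x, p) := by
  obtain ⟨ψ, h1, h2⟩ := hf.exists_eq_add_clm_apply
  refine ⟨fun z => ψ z 1, h1.clm_apply contDiff_const, fun x p => ?_⟩
  rw [h2, ← smul_eq_mul, ← map_smul, smul_eq_mul, mul_one]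

theorem deriv_mul_self_zero {g : ℝ → ℝ} (hg : DifferentiableAt ℝ g 0) :
    deriv (fun x => x * g x) 0 = g 0 := by
  rw [deriv_fun_mul differentiableAt_fun_id hg]
  simp

/-! ### Normal form of the response function and its scalar bifurcations -/

namespace FeedForward

variable {k : ℕ}

/-- Hadamard's lemma in the inputs splits off `h`. On zero inputs `f` is divisible by `x`, with
quotient `g (x, t)`; expanding `g` in `x` gives `a`, and `g (0, t)` is divisible by `t` because `g
(0, 0) = f_0 = 0`. -/
theorem V0.exists_normal_form {f : Response k} (hf : f ∈ V0 k) :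
    ∃ (a : ℝ × ℝ → ℝ) (b : ℝ → ℝ) (h : ℝ × (Fin k → ℝ) × ℝ → ((Fin k → ℝ) →L[ℝ] ℝ)),
      ContDiff ℝ ∞ a ∧ ContDiff ℝ ∞ b ∧ ContDiff ℝ ∞ h ∧
      (∀ x y t, f (x, y, t) = x ^ 2 * a (x, t) + x * t * b t + h (x, y, t) y) ∧
      d00 f = 2 * a (0, 0) ∧ d0par f = b 0 ∧ ∀ i, dInput f i = h (0, 0, 0) (Pi.single i 1) := by
  obtain ⟨⟨hs, h0⟩, hd0⟩ := hf
  have hinf : (∞ : WithTop ℕ∞) ≠ 0 := by simp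
  obtain ⟨h, hh, hfh⟩ := (hs.comp (by fun_prop : ContDiff ℝ ∞
    fun q : (Fin k → ℝ) × (ℝ × ℝ) => (q.2.1, q.1, q.2.2))).exists_eq_add_clm_apply
  obtain ⟨g, hg, hfg⟩ := (hs.comp (by fun_prop : ContDiff ℝ ∞
    fun q : ℝ × ℝ => (q.1, (0 : Fin k → ℝ), q.2))).exists_eq_add_mul
  simp only [Function.comp_apply, h0, zero_add] at hfh hfg
  obtain ⟨a, ha, hga⟩ := hg.exists_eq_add_mul
  have hgd : ∀ t, deriv (fun x => f (x, 0, t)) 0 = g (0, t) := fun t => by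
    simp_rw [hfg]
    exact deriv_mul_self_zero (g := fun x => g (x, t))
      ((hg.differentiable hinf).comp (by fun_prop : Differentiable ℝ fun x : ℝ => (x, t)) 0)
  obtain ⟨b, hb, hgb⟩ := (hg.comp (by fun_prop : ContDiff ℝ ∞
    fun q : ℝ × ℝ => ((0 : ℝ), q.1))).exists_eq_add_mul
  have hg00 : g (0, 0) = 0 := by rw [← hgd]; exact hd0
  simp only [Function.comp_apply, hg00, zero_add] at hgb
  have hb' : ContDiff ℝ ∞ fun t => b (t, 0) :=
    hb.comp (by fun_prop : ContDiff ℝ ∞ fun t : ℝ => (t, (0 : ℝ)))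
  have ha' : ContDiff ℝ ∞ fun x => a (x, 0) :=
    ha.comp (by fun_prop : ContDiff ℝ ∞ fun t : ℝ => (t, (0 : ℝ)))
  have hf00 : ∀ x, f (x, 0, 0) = x * (x * a (x, 0)) := fun x => by
    rw [hfg, hga, hg00, zero_add]
  refine ⟨a, fun t => b (t, 0), fun z => h (z.2.1, (z.1, z.2.2)), ha, hb', ?_, ?_, ?_, ?_, ?_⟩
  · exact hh.comp (by fun_prop : ContDiff ℝ ∞
      fun z : ℝ × (Fin k → ℝ) × ℝ => (z.2.1, (z.1, z.2.2)))
  · intro x y t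
    rw [hfh y (x, t), hfg, hga, hgb t 0]
    ring
  · have hda : Differentiable ℝ fun x => a (x, 0) := ha'.differentiable hinf
    have hda' : DifferentiableAt ℝ (deriv fun x => a (x, 0)) 0 :=
      ((contDiff_infty_iff_deriv.1 ha').2.differentiable hinf) 0
    have h1 : (deriv fun x => f (x, 0, 0)) =
        fun x => x * (2 * a (x, 0) + x * deriv (fun x => a (x, 0)) x) := by
      funext x
      simp_rw [hf00]
      rw [deriv_fun_mul differentiableAt_fun_id (differentiableAt_fun_id.fun_mul (hda x)),
        deriv_fun_mul differentiableAt_fun_id (hda x)]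
      simp
      ring
    rw [d00, iteratedDeriv_succ, iteratedDeriv_one, h1, deriv_mul_self_zero]
    · simp
    · exact ((hda 0).const_mul 2).add (differentiableAt_fun_id.mul hda')
  · rw [d0par]
    simp_rw [hgd]
    rw [show (fun t => g (0, t)) = fun t => t * b (t, 0) from funext fun t => hgb t 0,
      deriv_mul_self_zero (g := fun t => b (t, 0)) (hb'.differentiable hinf 0)]
  · intro i
    have h1 : ∀ x : ℝ, f (0, Pi.single i x, 0) =
        x * h (Pi.single i x, (0, 0)) (Pi.single i 1) := fun x => by
      rw [hfh (Pi.single i x) (0, 0), h0, zero_add, ← smul_eq_mul, ← map_smul, ← Pi.single_smul,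
        smul_eq_mul, mul_one]
    rw [dInput]
    simp_rw [h1]
    rw [deriv_mul_self_zero (g := fun x => h (Pi.single i x, (0, 0)) (Pi.single i 1))]
    · simp
    · refine ((hh.clm_apply contDiff_const).comp (?_ : ContDiff ℝ ∞
        fun x : ℝ => ((Pi.single i x : Fin k → ℝ), ((0 : ℝ), (0 : ℝ))))).differentiable hinf 0
      exact (contDiff_single (𝕜 := ℝ) (F' := fun _ : Fin k => ℝ) ∞ i).prodMk contDiff_const

open Filter Topology in
/-- Solutions `σ w` of `f (σ w, σ² u, σ v) = 0` bifurcating from the nondegenerate zeros of the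
quadratic part. -/
theorem V0.exists_smooth_solution {f : Response k} (hf : f ∈ V0 k) {σ v : ℝ → ℝ}
    {u : ℝ → Fin k → ℝ} (hσ : ContDiff ℝ ∞ σ) (hv : ContDiff ℝ ∞ v)
    (hu : ∀ᶠ s in 𝓝 0, ContDiffAt ℝ ∞ u s) (hσ0 : σ 0 = 0) {w₀ : ℝ}
    (hw : w₀ ^ 2 * (d00 f / 2) + w₀ * v 0 * d0par f + ∑ i, u 0 i * dInput f i = 0)
    (hw' : w₀ * d00 f + v 0 * d0par f ≠ 0) :
    ∃ w : ℝ → ℝ, w 0 = w₀ ∧ (∀ᶠ s in 𝓝 0, ContDiffAt ℝ ∞ w s) ∧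
      ∀ᶠ s in 𝓝 0, f (σ s * w s, σ s ^ 2 • u s, σ s * v s) = 0 := by
  obtain ⟨a, b, h, ha, hb, hh, hfe, h1, h2, h3⟩ := V0.exists_normal_form hf
  have hlin : ∀ y, h (0, 0, 0) y = ∑ i, y i * dInput f i := fun y => by
    conv_lhs => rw [pi_eq_sum_univ' y, map_sum]
    refine Finset.sum_congr rfl fun i _ => ?_
    rw [map_smul, h3, smul_eq_mul]
  -- `G (s, w)` is the desired equation divided by `σ s ^ 2`; at `s = 0` it becomes the quadratic
  -- equation `hw`, with simple root `w₀` by `hw'`.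
  set G : ℝ × ℝ → ℝ := fun z =>
    z.2 ^ 2 * a (σ z.1 * z.2, σ z.1 * v z.1) + z.2 * v z.1 * b (σ z.1 * v z.1) +
      h (σ z.1 * z.2, σ z.1 ^ 2 • u z.1, σ z.1 * v z.1) (u z.1) with hG
  have hG0 : (fun w : ℝ => G (0, w)) =
      fun w => w ^ 2 * a (0, 0) + w * v 0 * b 0 + h (0, 0, 0) (u 0) := by
    simp [hG, hσ0]
  have hGs : ∀ᶠ z in 𝓝 ((0 : ℝ), w₀), ContDiffAt ℝ ∞ G z := by
    have hfst : Tendsto Prod.fst (𝓝 ((0 : ℝ), w₀)) (𝓝 0) := continuous_fst.tendsto' _ _ rfl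
    filter_upwards [hfst.eventually hu] with z hz
    have hu' : ContDiffAt ℝ ∞ (fun z : ℝ × ℝ => u z.1) z := ContDiffAt.comp z hz contDiffAt_fst
    have hσ' : ContDiffAt ℝ ∞ (fun z : ℝ × ℝ => σ z.1) z := (hσ.comp contDiff_fst).contDiffAt
    have hv' : ContDiffAt ℝ ∞ (fun z : ℝ × ℝ => v z.1) z := (hv.comp contDiff_fst).contDiffAt
    have hz2 : ContDiffAt ℝ ∞ (fun z : ℝ × ℝ => z.2) z := contDiffAt_snd
    have e1 := ha.contDiffAt.comp z ((hσ'.mul hz2).prodMk (hσ'.mul hv'))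
    have e2 := hb.contDiffAt.comp z (hσ'.mul hv')
    have e3 := hh.contDiffAt.comp z
      ((hσ'.mul hz2).prodMk (((hσ'.pow 2).smul hu').prodMk (hσ'.mul hv')))
    exact (((hz2.pow 2).mul e1).add ((hz2.mul hv').mul e2)).add (e3.clm_apply hu')
  have hGd : HasDerivAt (fun w => G (0, w)) (w₀ * d00 f + v 0 * d0par f) w₀ := by
    rw [hG0, h1, h2]
    refine HasDerivAt.congr_deriv (((((hasDerivAt_id' w₀).pow 2).mul_const _).add
      (((hasDerivAt_id' w₀).mul_const _).mul_const _)).add_const _) ?_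
    simp
    ring
  have hGw : G (0, w₀) = 0 := by
    rw [h1, h2] at hw
    rw [congrFun hG0 w₀]
    rw [hlin]
    linarith
  obtain ⟨w, hw0, hws, hwG⟩ := ContDiff.exists_implicit hGs hGw hGd hw'
  refine ⟨w, hw0, hws, hwG.mono fun s hs => ?_⟩
  rw [hfe, map_smul, smul_eq_mul]
  linear_combination σ s ^ 2 * hs

end FeedForward

/-! ### Uniqueness of the quotient map from a backward connected lift -/

namespace Network

variable {k : ℕ} {C C' : Type*} {N : Network k C} {L : Network k C'}

theorem IsQuotientBy.exists_map {r : Setoid C'} (h : N.IsQuotientBy L r) :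
    ∃ π : C' → C, Function.Surjective π ∧ (∀ i, Function.Semiconj π (L.σ i) (N.σ i)) ∧
      ∀ c d, r c d ↔ π c = π d := by
  obtain ⟨hb, φ, hφ⟩ := h
  refine ⟨fun c => φ ⟦c⟧, φ.surjective.comp Quotient.mk_surjective, fun i c => ?_, fun c d => ?_⟩
  · exact hφ i ⟦c⟧
  · rw [φ.apply_eq_iff_eq, Quotient.eq]

theorem BackwardConnectedFor.induction {c : C'} (h : L.BackwardConnectedFor c) {P : C' → Prop}
    (h0 : P c) (hs : ∀ i d, P d → P (L.σ i d)) (d : C') : P d := by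
  by_cases hd : d = c
  · exact hd ▸ h0
  · refine Relation.TransGen.head_induction_on (h d hd) ?_ ?_
    · rintro a ⟨i, rfl⟩
      exact hs i c h0
    · rintro a b ⟨i, rfl⟩ _ hb
      exact hs i b hb

namespace IsFeedForward

variable {m n : ℕ} {layer : C → ℕ} {layer' : C' → ℕ}

/-- A proper input of a cell lies in a strictly lower layer, so nothing in the last layer other than
`c` can be reached backwards from `c`. -/
theorem eq_of_layer_eq (hL : L.IsFeedForward n layer') {c : C'} (hc : L.BackwardConnectedFor c)
    {d : C'} (hd : layer' d = n) : d = c := by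
  refine hc.induction (P := fun d => layer' d = n → d = c) (fun _ => rfl) (fun i e he hn => ?_) d hd
  by_cases h0 : layer' e = 0
  · rw [hL.first e h0 i] at hn ⊢
    exact he hn
  · have := hL.next e h0 i
    have := hL.layer_le e
    omega

/-- Following edges of type `i₀` from `c` reaches a fixed cell after `layer' c` steps. The image of
a fixed cell is fixed, hence lies in layer `0`, and the path in `N` descends one layer per step
until then. -/
theorem layer_map_le (hN : N.IsFeedForward m layer) (hL : L.IsFeedForward n layer') (i₀ : Fin k)
    {π : C' → C} (hπ : ∀ i, Function.Semiconj π (L.σ i) (N.σ i)) (c : C') :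
    layer (π c) ≤ layer' c := by
  induction hl : layer' c generalizing c with
  | zero =>
    by_contra h
    have h1 := hN.next (π c) (by omega) i₀
    rw [← hπ i₀ c, hL.first c hl i₀] at h1
    omega
  | succ a ih =>
    by_contra h
    have h1 := hN.next (π c) (by omega) i₀
    have h2 := ih (L.σ i₀ c) (by have := hL.next c (by omega) i₀; omega)
    rw [hπ i₀ c] at h2
    omega

/-- Layers cannot increase under `π`, so any preimage of a last-layer cell is in the last layer,
which consists of `c` alone. -/
theorem map_eq_of_layer_eq (hN : N.IsFeedForward m layer) (hL : L.IsFeedForward m layer')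
    (i₀ : Fin k) {c : C'} (hc : L.BackwardConnectedFor c) {π : C' → C}
    (hs : Function.Surjective π) (hπ : ∀ i, Function.Semiconj π (L.σ i) (N.σ i)) {a : C}
    (ha : layer a = m) : π c = a := by
  obtain ⟨d, rfl⟩ := hs a
  have h1 := hN.layer_map_le hL i₀ hπ d
  rw [hL.eq_of_layer_eq hc (le_antisymm (hL.layer_le d) (ha ▸ h1))]

theorem layer_map (hN : N.IsFeedForward m layer) (hL : L.IsFeedForward m layer')
    (i₀ : Fin k) {c : C'} (hc : L.BackwardConnectedFor c) {π : C' → C}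
    (hs : Function.Surjective π) (hπ : ∀ i, Function.Semiconj π (L.σ i) (N.σ i)) (d : C') :
    layer (π d) = layer' d := by
  refine hc.induction (P := fun d => layer (π d) = layer' d) ?_ (fun i e he => ?_) d
  · obtain ⟨a, ha⟩ := hN.layer_nonempty m le_rfl
    obtain ⟨d, hd⟩ := hL.layer_nonempty m le_rfl
    rw [hN.map_eq_of_layer_eq hL i₀ hc hs hπ ha, ← hL.eq_of_layer_eq hc hd, ha, hd]
  · rw [hπ i e]
    by_cases h0 : layer' e = 0
    · rw [hL.first e h0, hN.first _ (he.trans h0), he]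
    · have h1 := hL.next e h0 i
      have h2 := hN.next (π e) (by omega) i
      omega

/-- Both maps agree at `c`, and agreement passes from a cell to its inputs. -/
theorem quotientMap_unique (hN : N.IsFeedForward m layer) (hL : L.IsFeedForward m layer')
    (i₀ : Fin k) {c : C'} (hc : L.BackwardConnectedFor c) {π π' : C' → C}
    (hs : Function.Surjective π) (hπ : ∀ i, Function.Semiconj π (L.σ i) (N.σ i))
    (hs' : Function.Surjective π') (hπ' : ∀ i, Function.Semiconj π' (L.σ i) (N.σ i)) (d : C') :
    π d = π' d := by
  refine hc.induction (P := fun d => π d = π' d) ?_ (fun i e he => ?_) d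
  · obtain ⟨a, ha⟩ := hN.layer_nonempty m le_rfl
    rw [hN.map_eq_of_layer_eq hL i₀ hc hs hπ ha, hN.map_eq_of_layer_eq hL i₀ hc hs' hπ' ha]
  · rw [hπ i e, hπ' i e, he]

/-- If `L` is a backward connected lift of `N` inside a layer, then some pair of cells in this layer
is identified by every coloring of `L` with quotient `N`. -/
theorem exists_ne_forall_isQuotientBy [Finite C'] (hN : N.IsFeedForward m layer)
    (hL : L.IsFeedForward n layer') (hback : L.BackwardConnected) {j : ℕ} (hm : 0 < m)
    (hlift : N.IsLiftInsideLayer m layer L n layer' j) :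
    ∃ c d, c ≠ d ∧ layer' c = j ∧ layer' d = j ∧ ∀ r, N.IsQuotientBy L r → r c d := by
  obtain rfl := hlift.length_eq
  obtain ⟨c₀, hc₀⟩ := hback
  obtain ⟨i₀⟩ : Nonempty (Fin k) := by
    obtain ⟨e, he⟩ := hL.layer_nonempty 0 (Nat.zero_le m)
    obtain ⟨-, i, -⟩ := hL.source e (he ▸ hm)
    exact ⟨i⟩
  obtain ⟨r, hr⟩ := hlift.isLift
  obtain ⟨π, hs, hπ, -⟩ := hr.exists_map
  have hl := hN.layer_map hL i₀ hc₀ hs hπ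
  have himage : π '' {c | layer' c = j} = {a | layer a = j} := by
    ext a
    constructor
    · rintro ⟨c, hc, rfl⟩
      exact (hl c).trans hc
    · intro ha
      obtain ⟨c, rfl⟩ := hs a
      exact ⟨c, (hl c).symm.trans ha, rfl⟩
  have hinj : ¬ Set.InjOn π {c | layer' c = j} := fun h =>
    hlift.card_ne (by rw [layerCard, layerCard, ← himage, h.ncard_image])
  simp only [Set.InjOn, Set.mem_ofPred_eq, not_forall] at hinj
  obtain ⟨c, hc, d, hd, hcd, hne⟩ := hinj
  refine ⟨c, d, hne, hc, hd, fun r' hr' => ?_⟩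
  obtain ⟨π', hs', hπ', hk⟩ := hr'.exists_map
  have hu := hN.quotientMap_unique hL i₀ hc₀ hs' hπ' hs hπ
  rw [hk, hu, hu, hcd]

end IsFeedForward

end Network

/-! ### A first-order invariant of germ equivalence -/

open Asymptotics Filter Topology in
-- Both sides say that `g` vanishes at `0` with zero derivative, and the derivative is already
-- determined along `S`.
theorem isLittleO_id_nhdsWithin_iff {g : ℝ → ℝ} (hg : DifferentiableAt ℝ g 0) {S : Set ℝ}
    (h0 : (0 : ℝ) ∈ S) (hS : UniqueDiffWithinAt ℝ S 0) :
    g =o[𝓝[S] 0] (id : ℝ → ℝ) ↔ g =o[𝓝 0] (id : ℝ → ℝ) := by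
  refine ⟨fun h => ?_, fun h => h.mono nhdsWithin_le_nhds⟩
  have hg0 : g 0 = 0 := by
    simpa using (h.def one_pos).self_of_nhdsWithin h0
  have h1 : HasDerivWithinAt g 0 S 0 := by
    rw [hasDerivWithinAt_iff_isLittleO]
    simp only [hg0, sub_zero, smul_zero]
    exact h
  have h2 := hg.hasDerivAt
  rw [hS.eq_deriv _ h2.hasDerivWithinAt h1, hasDerivAt_iff_isLittleO] at h2
  simp only [hg0, sub_zero, smul_zero] at h2
  exact h2

namespace FeedForward

variable {C : Type*}

open Asymptotics Filter Topology Set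

/-- A two-sided branch is differentiable at `0`, so one side decides. A one-sided branch loses
nothing near `0`, since `hU` excludes a second domain on the opposite side. -/
theorem Branch.isLittleO_nhdsWithin_inter_iff (b b' : Branch C) {U : Set ℝ} (h0 : 0 ∈ U)
    (hU : U ∩ b.dom ∩ b'.dom ≠ {0}) (c d : C) :
    (fun t => b.toFun t c - b.toFun t d) =o[𝓝[b.dom ∩ b'.dom] 0] (id : ℝ → ℝ) ↔
      (fun t => b.toFun t c - b.toFun t d) =o[𝓝[b.dom] 0] (id : ℝ → ℝ) := by
  have key : ∀ {ρ ρ' : ℝ}, 0 < ρ → 0 < ρ' → U ∩ (Ico 0 ρ ∩ Ioc (-ρ') 0) = {0} := by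
    intro ρ ρ' hρ hρ'
    ext t
    simp only [mem_inter_iff, mem_Ico, mem_Ioc, mem_singleton_iff]
    constructor
    · rintro ⟨-, ⟨h1, -⟩, -, h2⟩
      exact le_antisymm h2 h1
    · rintro rfl
      exact ⟨h0, ⟨le_rfl, hρ⟩, by linarith, le_rfl⟩
  rw [inter_assoc] at hU
  obtain ⟨ρ', hρ', hd'⟩ : ∃ ρ' > 0, b'.dom = Ioo (-ρ') ρ' ∨ b'.dom = Ico 0 ρ' ∨
      b'.dom = Ioc (-ρ') 0 := by
    obtain ⟨ρ', h, h', -⟩ | ⟨ρ', h, h', -⟩ := b'.regular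
    exacts [⟨ρ', h, .inl h'⟩, ⟨ρ', h, .inr h'⟩]
  obtain ⟨ρ, hρ, hd, hreg⟩ | ⟨ρ, hρ, hd, -⟩ := b.regular
  · have hmem : Ioo (-ρ) ρ ∈ 𝓝 (0 : ℝ) := Ioo_mem_nhds (by linarith) hρ
    have hmem' : Ioo (-ρ') ρ' ∈ 𝓝 (0 : ℝ) := Ioo_mem_nhds (by linarith) hρ'
    have hdiff : DifferentiableAt ℝ (fun t => b.toFun t c - b.toFun t d) 0 := by
      have h : ∀ e, DifferentiableAt ℝ (fun t => b.toFun t e) 0 := fun e =>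
        ((hreg e).contDiffAt (hd ▸ hmem)).differentiableAt (by simp)
      exact (h c).sub (h d)
    rw [hd, nhdsWithin_inter_of_mem (mem_nhdsWithin_of_mem_nhds hmem), nhdsWithin_eq_nhds.2 hmem]
    refine isLittleO_id_nhdsWithin_iff hdiff ?_ ?_
    · obtain h | h | h := hd' <;> rw [h] <;> constructor <;> linarith
    · obtain h | h | h := hd' <;> rw [h]
      · exact uniqueDiffWithinAt_of_mem_nhds hmem'
      · exact uniqueDiffOn_Ico 0 ρ' 0 ⟨le_rfl, hρ'⟩
      · exact uniqueDiffOn_Ioc (-ρ') 0 0 ⟨by linarith, le_rfl⟩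
  · obtain h | h | h := hd'
    · rw [h, inter_comm, nhdsWithin_inter_of_mem
        (mem_nhdsWithin_of_mem_nhds (Ioo_mem_nhds (by linarith) hρ'))]
    · obtain h' | h' := hd
      · rw [h, h', Ico_inter_Ico, max_self, nhdsWithin_Ico_eq_nhdsGE hρ,
          nhdsWithin_Ico_eq_nhdsGE (lt_min hρ hρ')]
      · rw [h, h', inter_comm (Ioc _ _), key hρ' hρ] at hU
        exact absurd rfl hU
    · obtain h' | h' := hd
      · rw [h, h', key hρ hρ'] at hU
        exact absurd rfl hU
      · rw [h, h', Ioc_inter_Ioc, min_self, nhdsWithin_Ioc_eq_nhdsLE (neg_lt_zero.2 hρ),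
          nhdsWithin_Ioc_eq_nhdsLE (max_lt (neg_lt_zero.2 hρ) (neg_lt_zero.2 hρ'))]

theorem Branch.GermEquiv.isLittleO_iff {b b' : Branch C} (h : b.GermEquiv b') (c d : C) :
    (fun t => b.toFun t c - b.toFun t d) =o[𝓝[b.dom] 0] (id : ℝ → ℝ) ↔
      (fun t => b'.toFun t c - b'.toFun t d) =o[𝓝[b'.dom] 0] (id : ℝ → ℝ) := by
  induction h with
  | refl => rfl
  | symm _ _ _ ih => exact ih.symm
  | trans _ _ _ _ _ ih ih' => exact ih.trans ih'
  | rel b b' h =>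
    obtain ⟨U, hU, h0, hne, heq⟩ := h
    rw [← b.isLittleO_nhdsWithin_inter_iff b' h0 hne,
      ← b'.isLittleO_nhdsWithin_inter_iff b h0 (by rwa [inter_right_comm]), inter_comm b'.dom]
    refine isLittleO_congr ?_ .rfl
    filter_upwards [mem_nhdsWithin_of_mem_nhds (hU.mem_nhds h0), self_mem_nhdsWithin] with t h1 h2
    rw [heq t ⟨⟨h1, h2.1⟩, h2.2⟩]

theorem not_isLiftedFrom {k : ℕ} {C' : Type*} {N : Network k C} {L : Network k C'} {b : Branch C'}
    {c d : C'} (h : ∀ r, N.IsQuotientBy L r → r c d)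
    (hb : ¬ (fun t => b.toFun t c - b.toFun t d) =o[𝓝[b.dom] 0] (id : ℝ → ℝ)) :
    ¬ IsLiftedFrom N L b := by
  rintro ⟨r, hr, b', hbb', hpoly⟩
  refine hb ((hbb'.isLittleO_iff c d).2 ((isLittleO_zero _ _).congr' ?_ .rfl))
  filter_upwards [self_mem_nhdsWithin] with t ht
  rw [hpoly t ht c d (h r hr), sub_self]

theorem not_germEquiv_trivial {b : Branch C} {c d : C}
    (hb : ¬ (fun t => b.toFun t c - b.toFun t d) =o[𝓝[b.dom] 0] (id : ℝ → ℝ)) :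
    ¬ b.GermEquiv (Branch.trivial C) := fun h =>
  hb ((h.isLittleO_iff c d).2 (by simp [Branch.trivial]))

end FeedForward

/-! ### Openness and density of the nondegeneracy conditions -/

namespace FeedForward

variable {k : ℕ}

theorem deriv_fst_eq_fderiv {f : Response k} (hf : ContDiff ℝ ∞ f) (x t : ℝ) :
    deriv (fun x => f (x, 0, t)) x = fderiv ℝ f (x, 0, t) (1, 0, 0) :=
  (((hf.differentiable (by simp)) (x, 0, t)).hasFDerivAt.comp_hasDerivAt x
    ((hasDerivAt_id' x).prodMk (hasDerivAt_const x ((0 : Fin k → ℝ), t)))).deriv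

theorem deriv_fderiv_line {f : Response k} (hf : ContDiff ℝ ∞ f) (v w : ℝ × (Fin k → ℝ) × ℝ) :
    deriv (fun s : ℝ => fderiv ℝ f (s • v) w) 0 = iteratedFDeriv ℝ 2 f 0 ![v, w] := by
  rw [iteratedFDeriv_two_apply]
  have h1 : HasDerivAt (fun s : ℝ => s • v) v 0 := by
    simpa using (hasDerivAt_id (0 : ℝ)).smul_const v
  have h2 : HasFDerivAt (fderiv ℝ f) (fderiv ℝ (fderiv ℝ f) 0) ((0 : ℝ) • v) := by
    rw [zero_smul]
    exact ((contDiff_infty_iff_fderiv.1 hf).2.differentiable (by simp) 0).hasFDerivAt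
  have h3 : HasDerivAt (fun s : ℝ => fderiv ℝ f (s • v)) (fderiv ℝ (fderiv ℝ f) 0 v) 0 :=
    h2.comp_hasDerivAt (0 : ℝ) h1
  have h4 := h3.clm_apply (hasDerivAt_const (0 : ℝ) w)
  rw [h4.deriv]
  simp

theorem d00_eq_iteratedFDeriv {f : Response k} (hf : ContDiff ℝ ∞ f) :
    d00 f = iteratedFDeriv ℝ 2 f 0 ![(1, 0, 0), (1, 0, 0)] := by
  rw [d00, iteratedDeriv_succ, iteratedDeriv_one, ← deriv_fderiv_line hf]
  simp [funext fun x => deriv_fst_eq_fderiv hf x 0]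

theorem d0par_eq_iteratedFDeriv {f : Response k} (hf : ContDiff ℝ ∞ f) :
    d0par f = iteratedFDeriv ℝ 2 f 0 ![(0, 0, 1), (1, 0, 0)] := by
  rw [d0par, ← deriv_fderiv_line hf]
  simp [deriv_fst_eq_fderiv hf]

theorem abs_iteratedFDeriv_two_apply_sub_le {f g : Response k} (hf : ContDiff ℝ ∞ f)
    (hg : ContDiff ℝ ∞ g) {v w : ℝ × (Fin k → ℝ) × ℝ} (hv : ‖v‖ ≤ 1) (hw : ‖w‖ ≤ 1) :
    |iteratedFDeriv ℝ 2 g 0 ![v, w] - iteratedFDeriv ℝ 2 f 0 ![v, w]| ≤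
      ‖iteratedFDeriv ℝ 2 (g - f) 0‖ := by
  have h2 : ∀ i : ℕ, (i : WithTop ℕ∞) ≤ ∞ := fun i => by exact_mod_cast le_top
  have h := iteratedFDeriv_sub_apply (i := 2) (x := 0) (hg.contDiffAt.of_le (h2 2))
    (hf.contDiffAt.of_le (h2 2))
  rw [← sub_apply, ← h, ← Real.norm_eq_abs]
  refine (ContinuousMultilinearMap.le_opNorm _ _).trans ?_
  rw [Fin.prod_univ_two]
  exact mul_le_of_le_one_right (norm_nonneg _) (mul_le_one₀ hv (norm_nonneg _) hw)

/-- The perturbation used for the density of the nondegeneracy conditions. -/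
def quadratic (k : ℕ) : Response k := fun z => z.1 ^ 2 + z.1 * z.2.2

theorem contDiff_quadratic : ContDiff ℝ ∞ (quadratic k) := by
  unfold quadratic
  fun_prop

theorem add_smul_quadratic_mem_V0 {f : Response k} (hf : f ∈ V0 k) (δ : ℝ) :
    f + δ • quadratic k ∈ V0 k ∧ d00 (f + δ • quadratic k) = d00 f + 2 * δ ∧
      d0par (f + δ • quadratic k) = d0par f + δ := by
  have hs := hf.1.1
  have hx : ∀ x t, deriv (fun x => (f + δ • quadratic k) (x, 0, t)) x =
      deriv (fun x => f (x, 0, t)) x + δ * (2 * x + t) := by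
    intro x t
    have h1 : DifferentiableAt ℝ (fun x => f (x, 0, t)) x :=
      (hs.differentiable (by simp)).comp
        (by fun_prop : Differentiable ℝ fun x : ℝ => (x, (0 : Fin k → ℝ), t)) x
    have h2 : HasDerivAt (fun x : ℝ => δ * (x ^ 2 + x * t)) (δ * (2 * x + t)) x := by
      refine HasDerivAt.congr_deriv ((((hasDerivAt_id' x).pow 2).add
        ((hasDerivAt_id' x).mul_const t)).const_mul δ) ?_
      simp
    exact (h1.hasDerivAt.add h2).deriv
  have hF := (contDiff_infty_iff_fderiv.1 hs).2
  refine ⟨⟨⟨hs.add (contDiff_quadratic.const_smul δ), fun t => ?_⟩, ?_⟩, ?_, ?_⟩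
  · simp [hf.1.2 t, quadratic]
  · rw [d0, hx, show deriv (fun x => f (x, 0, 0)) 0 = 0 from hf.2]
    simp
  · rw [d00, d00, iteratedDeriv_succ, iteratedDeriv_one, iteratedDeriv_succ, iteratedDeriv_one]
    simp_rw [funext fun x => hx x 0]
    have h1 : DifferentiableAt ℝ (deriv fun x => f (x, 0, 0)) 0 := by
      rw [funext fun x => deriv_fst_eq_fderiv hs x 0]
      exact ((hF.comp (by fun_prop : ContDiff ℝ ∞ fun x : ℝ => (x, (0 : Fin k → ℝ), (0 : ℝ))
        )).clm_apply contDiff_const).differentiable (by simp) 0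
    have h2 : HasDerivAt (fun x : ℝ => δ * (2 * x + 0)) (2 * δ) 0 := by
      refine HasDerivAt.congr_deriv ((((hasDerivAt_id' (0 : ℝ)).const_mul 2).add_const
        0).const_mul δ) ?_
      ring
    exact (h1.hasDerivAt.add h2).deriv
  · rw [d0par, d0par]
    simp_rw [hx 0]
    have h1 : DifferentiableAt ℝ (fun t => deriv (fun x => f (x, 0, t)) 0) 0 := by
      simp_rw [deriv_fst_eq_fderiv hs]
      exact ((hF.comp (by fun_prop : ContDiff ℝ ∞ fun t : ℝ => ((0 : ℝ), (0 : Fin k → ℝ), t)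
        )).clm_apply contDiff_const).differentiable (by simp) 0
    have h2 : HasDerivAt (fun t : ℝ => δ * (2 * 0 + t)) δ 0 := by
      refine HasDerivAt.congr_deriv (((hasDerivAt_id' (0 : ℝ)).const_add (2 * 0)).const_mul δ) ?_
      ring
    exact (h1.hasDerivAt.add h2).deriv

open Filter Topology in
theorem openDenseIn_V0gen (k : ℕ) : OpenDenseIn (V0 k) (V0gen k) where
  subset f hf := hf.1
  isOpen f hf := by
    obtain ⟨hf, h1, h2⟩ := hf
    -- If one of the two second derivatives vanished for `g`, the second derivative of `g - f` at
    -- the origin would have norm at least this radius.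
    refine ⟨{0}, 2, min |d00 f| |d0par f|, lt_min (abs_pos.2 h1) (abs_pos.2 h2),
      isCompact_singleton, fun g hg hclose => ⟨hg, fun h => ?_, fun h => ?_⟩⟩
    all_goals
      have hc := hclose 2 le_rfl 0 rfl
      have hn : ‖((1 : ℝ), (0 : Fin k → ℝ), (0 : ℝ))‖ ≤ 1 := by simp [Prod.norm_def]
      have hn' : ‖((0 : ℝ), (0 : Fin k → ℝ), (1 : ℝ))‖ ≤ 1 := by simp [Prod.norm_def]
    · have h3 := abs_iteratedFDeriv_two_apply_sub_le hf.1.1 hg.1.1 hn hn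
      rw [← d00_eq_iteratedFDeriv hf.1.1, ← d00_eq_iteratedFDeriv hg.1.1, h, zero_sub, abs_neg]
        at h3
      exact absurd (h3.trans_lt hc) (not_lt.2 (min_le_left _ _))
    · have h3 := abs_iteratedFDeriv_two_apply_sub_le hf.1.1 hg.1.1 hn' hn
      rw [← d0par_eq_iteratedFDeriv hf.1.1, ← d0par_eq_iteratedFDeriv hg.1.1, h, zero_sub, abs_neg]
        at h3
      exact absurd (h3.trans_lt hc) (not_lt.2 (min_le_right _ _))
  dense f hf K r ε hε hK := by
    have hB : ∀ i ∈ Set.Iic r, ∀ᶠ δ in 𝓝[≠] (0 : ℝ), ∀ z ∈ K,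
        ‖iteratedFDeriv ℝ i (δ • quadratic k) z‖ < ε := by
      intro i _
      have hi : (i : WithTop ℕ∞) ≤ ∞ := by exact_mod_cast le_top
      obtain ⟨B, hB⟩ := hK.exists_bound_of_continuousOn
        ((contDiff_quadratic (k := k)).continuous_iteratedFDeriv hi).continuousOn
      have ht : Tendsto (fun δ : ℝ => ‖δ‖ * B) (𝓝[≠] 0) (𝓝 0) := by
        have : Continuous fun δ : ℝ => ‖δ‖ * B := by fun_prop
        exact (this.tendsto' 0 0 (by simp)).mono_left nhdsWithin_le_nhds
      filter_upwards [ht.eventually (gt_mem_nhds hε)] with δ hδ z hz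
      rw [iteratedFDeriv_const_smul_apply (contDiff_quadratic.contDiffAt.of_le hi), norm_smul]
      exact (mul_le_mul_of_nonneg_left (hB z hz) (norm_nonneg _)).trans_lt hδ
    have hne : ∀ a : ℝ, ∀ᶠ δ in 𝓝[≠] (0 : ℝ), δ ≠ a := fun a => by
      by_cases ha : a = 0
      · exact ha ▸ self_mem_nhdsWithin
      · exact eventually_nhdsWithin_of_eventually_nhds (eventually_ne_nhds (Ne.symm ha))
    -- Adding `δ • quadratic k` shifts `d00` by `2 * δ` and `d0par` by `δ`, so only two values of
    -- `δ` are forbidden.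
    obtain ⟨δ, h1, h2, h3⟩ := (((Set.finite_Iic r).eventually_all.2 hB).and
      ((hne (-d00 f / 2)).and (hne (-d0par f)))).exists
    obtain ⟨h4, h5, h6⟩ := add_smul_quadratic_mem_V0 hf δ
    refine ⟨f + δ • quadratic k, ⟨h4, ?_, ?_⟩, fun i hi z hz => ?_⟩
    · rw [h5]
      exact fun h => h2 (by linarith)
    · rw [h6]
      exact fun h => h3 (by linarith)
    · rw [add_sub_cancel_left]
      exact h1 i hi z hz

end FeedForward

/-! ### Layer-by-layer construction of the separating branch -/

namespace FeedForward

open Filter Topology Set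

variable {k : ℕ} {C' : Type*}

/-- The germ at `0` of `x` is `s ^ q` times a smooth function with value of the sign of `η`. -/
def HasSignedOrder (η : ℝ) (q : ℕ) (x : ℝ → ℝ) : Prop :=
  ∃ u : ℝ → ℝ, (∀ᶠ s in 𝓝 0, ContDiffAt ℝ ∞ u s) ∧ 0 < η * u 0 ∧ x = fun s => s ^ q * u s

theorem HasSignedOrder.eventually_contDiffAt {η : ℝ} {q : ℕ} {x : ℝ → ℝ}
    (h : HasSignedOrder η q x) : ∀ᶠ s in 𝓝 0, ContDiffAt ℝ ∞ x s := by
  obtain ⟨u, hu, -, rfl⟩ := h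
  exact hu.mono fun s hs => (contDiffAt_id.pow q).mul hs

/-- Besides `x = 0` there is a transcritical branch `x ≈ -2 (f_{0λ} / f_{00}) λ`; the sign condition
on `ε` selects the side of the parameter on which it has sign `η`. -/
theorem V0gen.exists_solution_of_zero_inputs {f : Response k} (hf : f ∈ V0gen k) {η ε : ℝ}
    (hε : ε * d0par f * d00 f * η < 0) (m : ℕ) :
    ∃ x, HasSignedOrder η (2 ^ m) x ∧ ∀ᶠ s in 𝓝 0, f (x s, 0, ε * s ^ 2 ^ m) = 0 := by
  obtain ⟨hf0, h00, h0p⟩ := hf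
  obtain ⟨w, hw0, hws, hw⟩ := V0.exists_smooth_solution hf0 (σ := fun s => ε * s ^ 2 ^ m)
    (v := fun _ => 1) (u := fun _ => 0) (w₀ := -2 * d0par f / d00 f) (by fun_prop) (by fun_prop)
    (Eventually.of_forall fun _ => contDiffAt_const) (by simp)
    (by simp; field_simp; ring)
    (by
      rw [div_mul_cancel₀ _ h00]
      intro h
      exact h0p (by linarith))
  refine ⟨fun s => ε * s ^ 2 ^ m * w s, ⟨fun s => ε * w s, ?_, ?_, ?_⟩, ?_⟩
  · exact hws.mono fun s hs => contDiffAt_const.mul hs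
  · have h1 : η * (ε * w 0) = -2 * (ε * d0par f * d00 f * η) / d00 f ^ 2 := by
      rw [hw0]
      field_simp
    rw [h1]
    exact div_pos (by linarith) (by positivity)
  · funext s
    ring
  · exact hw.mono fun s hs => by simpa using hs

/-- With `x = s ^ 2 ^ r * w`, the terms `x ^ 2` and the inputs balance at order `s ^ 2 ^ (r + 1)`,
while `x * λ` is of higher order because `r < m`. The sign hypotheses make `w ^ 2` positive at `s =
0`, and the root of sign `η` is taken. -/
theorem V0gen.exists_solution_of_inputs {f : Response k} (hf : f ∈ V0gen k) {η : ℝ} (ε : ℝ)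
    (hη1 : η ^ 2 = 1) (hη : ∀ i, η * dInput f i * d00 f < 0) {m r : ℕ} (hr : r < m)
    {u : ℝ → Fin k → ℝ} (hu : ∀ᶠ s in 𝓝 0, ContDiffAt ℝ ∞ u s) (hu0 : ∀ i, 0 ≤ η * u 0 i)
    {i₀ : Fin k} (hi₀ : 0 < η * u 0 i₀) :
    ∃ x, HasSignedOrder η (2 ^ r) x ∧
      ∀ᶠ s in 𝓝 0, f (x s, fun i => s ^ 2 ^ (r + 1) * u s i, ε * s ^ 2 ^ m) = 0 := by
  obtain ⟨hf0, h00, -⟩ := hf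
  have hlt : 2 ^ r < 2 ^ m := Nat.pow_lt_pow_right one_lt_two hr
  have hle : ∀ i, u 0 i * dInput f i * d00 f = (η * u 0 i) * (η * dInput f i * d00 f) := fun i => by
    linear_combination (-u 0 i * dInput f i * d00 f) * hη1
  have hsum : (∑ i, u 0 i * dInput f i) * d00 f < 0 := by
    rw [Finset.sum_mul]
    refine Finset.sum_neg' (fun i _ => ?_) ⟨i₀, Finset.mem_univ _, ?_⟩
    · rw [hle]
      exact mul_nonpos_of_nonneg_of_nonpos (hu0 i) (hη i).le
    · rw [hle]
      exact mul_neg_of_pos_of_neg hi₀ (hη i₀)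
  set A := ∑ i, u 0 i * dInput f i
  have hpos : 0 < -2 * A / d00 f := by
    rw [show -2 * A / d00 f = -2 * (A * d00 f) / d00 f ^ 2 by field_simp]
    exact div_pos (by linarith) (by positivity)
  have hsq := Real.sq_sqrt hpos.le
  have hsq0 := Real.sqrt_pos.2 hpos
  have hη0 : η ≠ 0 := by
    rintro rfl
    norm_num at hη1
  obtain ⟨w, hw0, hws, hw⟩ := V0.exists_smooth_solution hf0 (σ := fun s => s ^ 2 ^ r)
    (v := fun s => ε * s ^ (2 ^ m - 2 ^ r)) (u := u) (w₀ := η * √(-2 * A / d00 f))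
    (by fun_prop) (by fun_prop) hu (by simp)
    (by
      simp only [zero_pow (Nat.sub_ne_zero_of_lt hlt), mul_zero, zero_mul, add_zero]
      rw [mul_pow, hη1, hsq]
      field_simp
      ring)
    (by
      simp only [zero_pow (Nat.sub_ne_zero_of_lt hlt), mul_zero, zero_mul, add_zero]
      exact mul_ne_zero (mul_ne_zero hη0 hsq0.ne') h00)
  refine ⟨fun s => s ^ 2 ^ r * w s, ⟨w, hws, ?_, rfl⟩, hw.mono fun s hs => ?_⟩
  · rw [hw0, ← mul_assoc, ← sq, hη1, one_mul]
    exact hsq0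
  · have h1 : (s ^ 2 ^ r) ^ 2 • u s = fun i => s ^ 2 ^ (r + 1) * u s i := by
      rw [← pow_mul, ← pow_succ]
      rfl
    have h2 : s ^ 2 ^ r * (ε * s ^ (2 ^ m - 2 ^ r)) = ε * s ^ 2 ^ m := by
      rw [mul_left_comm, ← pow_add, Nat.add_sub_cancel' hlt.le]
    rwa [h1, h2] at hs

theorem V0gen.exists_solution {f : Response k} (hf : f ∈ V0gen k) {η ε : ℝ}
    (hη1 : η ^ 2 = 1) (hη : ∀ i, η * dInput f i * d00 f < 0) (hε : ε * d0par f * d00 f * η < 0)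
    {m R : ℕ} (hR : R < m) {y : Fin k → ℝ → ℝ}
    (hy : ∀ i, y i = 0 ∨ ∃ q, R < q ∧ q ≤ m ∧ HasSignedOrder η (2 ^ q) (y i)) :
    ∃ x, (∃ q, R ≤ q ∧ q ≤ m ∧ HasSignedOrder η (2 ^ q) x) ∧
      ∀ᶠ s in 𝓝 0, f (x s, fun i => y i s, ε * s ^ 2 ^ m) = 0 := by
  classical
  by_cases h0 : ∀ i, y i = 0
  · obtain ⟨x, hx, hx'⟩ := V0gen.exists_solution_of_zero_inputs hf hε m
    refine ⟨x, ⟨m, hR.le, le_rfl, hx⟩, ?_⟩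
    simp only [h0]
    exact hx'
  · push Not at h0
    have hex : ∃ q, ∃ i, R < q ∧ q ≤ m ∧ HasSignedOrder η (2 ^ q) (y i) := by
      obtain ⟨i, hi⟩ := h0
      obtain ⟨q, hq⟩ := (hy i).resolve_left hi
      exact ⟨q, i, hq⟩
    obtain ⟨i₀, h1, h2, h3⟩ := Nat.find_spec hex
    -- The smallest `q` among the nonzero inputs exceeds `R ≥ 0`, so its exponent `2 ^ q` can be
    -- halved.
    obtain ⟨r, hr⟩ := Nat.exists_eq_succ_of_ne_zero (Nat.ne_of_gt (Nat.zero_lt_of_lt h1))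
    have hu : ∀ i, ∃ u : ℝ → ℝ, (∀ᶠ s in 𝓝 0, ContDiffAt ℝ ∞ u s) ∧ 0 ≤ η * u 0 ∧
        (i = i₀ → 0 < η * u 0) ∧ y i = fun s => s ^ 2 ^ (r + 1) * u s := by
      intro i
      by_cases hi : i = i₀
      · obtain ⟨u, hu, hu', hyu⟩ := h3
        refine ⟨u, hu, hu'.le, fun _ => hu', ?_⟩
        rw [hi, hyu, hr]
      obtain h | ⟨q, hq, hqm, u, hu, hu', hyu⟩ := hy i
      · refine ⟨0, Eventually.of_forall fun _ => contDiffAt_const, by simp, fun h' => absurd h' hi, ?_⟩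
        rw [h]
        funext
        simp
      · have hrq : r + 1 ≤ q := hr.symm.trans_le <| Nat.find_min' hex ⟨i, hq, hqm, u, hu, hu', hyu⟩
        have hle : 2 ^ (r + 1) ≤ 2 ^ q := Nat.pow_le_pow_right two_pos hrq
        -- Inputs of higher order contribute zero at leading order; those of the minimal order
        -- contribute with sign `η`.
        refine ⟨fun s => s ^ (2 ^ q - 2 ^ (r + 1)) * u s,
          hu.mono fun s hs => (contDiffAt_id.pow _).mul hs, ?_, fun h' => absurd h' hi, ?_⟩
        · by_cases he : 2 ^ q - 2 ^ (r + 1) = 0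
          · simpa [he] using hu'.le
          · simp [zero_pow he]
        · rw [hyu]
          funext s
          rw [← mul_assoc, ← pow_add, Nat.add_sub_cancel' hle]
    choose u hus hu0 hui hyu using hu
    obtain ⟨x, hx, hx'⟩ := V0gen.exists_solution_of_inputs hf ε hη1 hη (m := m) (r := r)
      (by omega) (u := fun s i => u i s)
      ((eventually_all.2 hus).mono fun s hs => contDiffAt_pi.2 hs) hu0 (hui i₀ rfl)
    refine ⟨x, ⟨r, by omega, by omega, hx⟩, ?_⟩
    simpa only [hyu] using hx'

/-- The layerwise construction of a family of equilibria which vanishes below layer `j` and at the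
cell `d` of layer `j`, but not at the other cells of layer `j`. -/
theorem exists_layerwise_solution {L : Network k C'} {m : ℕ} {layer : C' → ℕ}
    (hL : L.IsFeedForward m layer) {f : Response k} (hf : f ∈ V0gen k) {η ε : ℝ}
    (hη1 : η ^ 2 = 1) (hη : ∀ i, η * dInput f i * d00 f < 0) (hε : ε * d0par f * d00 f * η < 0)
    {j : ℕ} (hj : 0 < j) {c d : C'} (hcd : c ≠ d) (hc : layer c = j) (hd : layer d = j)
    (l : ℕ) (hjl : j ≤ l) (hlm : l ≤ m) :
    ∃ x : C' → ℝ → ℝ, x d = 0 ∧ HasSignedOrder η (2 ^ m) (x c) ∧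
      (∀ e, layer e ≤ l → x e = 0 ∨
        ∃ q, m ≤ q + layer e ∧ q ≤ m ∧ HasSignedOrder η (2 ^ q) (x e)) ∧
      ∀ e, layer e ≤ l →
        ∀ᶠ s in 𝓝 0, f (x e s, fun i => x (L.σ i e) s, ε * s ^ 2 ^ m) = 0 := by
  classical
  have hlow : ∀ e i, layer (L.σ i e) ≤ layer e := fun e i => by
    by_cases h : layer e = 0
    · rw [hL.first e h]
    · have := hL.next e h i
      omega
  induction l, hjl using Nat.le_induction with
  | base =>
    obtain ⟨X, hX, hX'⟩ := V0gen.exists_solution_of_zero_inputs hf hε m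
    -- Cells of layer `j` see only zero inputs, so each may independently take the zero or the
    -- nonzero solution. The values above layer `j` are placeholders.
    refine ⟨fun e => if layer e = j ∧ e ≠ d then X else 0, by simp, by simpa [hc, hcd],
      fun e he => ?_, fun e he => ?_⟩
    · dsimp only
      split_ifs with h
      · exact .inr ⟨m, by omega, le_rfl, hX⟩
      · exact .inl rfl
    · have hin : ∀ i, layer (L.σ i e) ≠ j := fun i => by
        by_cases h : layer e = 0
        · rw [hL.first e h]
          omega
        · have := hL.next e h i
          omega
      simp only [hin, false_and, if_false]
      split_ifs with h
      · exact hX'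
      · exact Eventually.of_forall fun s => hf.1.1.2 _
  | succ l hjl ih =>
    obtain ⟨x, hxd, hxc, hx, heq⟩ := ih (by omega)
    have hstep : ∀ e, ∃ z : ℝ → ℝ, layer e = l + 1 →
        (∃ q, m ≤ q + layer e ∧ q ≤ m ∧ HasSignedOrder η (2 ^ q) z) ∧
        ∀ᶠ s in 𝓝 0, f (z s, fun i => x (L.σ i e) s, ε * s ^ 2 ^ m) = 0 := by
      intro e
      by_cases he : layer e = l + 1
      swap
      · exact ⟨0, fun h => absurd h he⟩
      -- Inputs from layer `l` have `q ≥ m - l`, hence `q > R` for `R = m - (l + 1)`.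
      obtain ⟨z, ⟨q, hq⟩, hz⟩ := V0gen.exists_solution hf hη1 hη hε (m := m) (R := m - (l + 1))
        (by omega) (y := fun i => x (L.σ i e)) fun i => by
          have hi := hL.next e (by omega) i
          obtain h | ⟨q, h1, h2, h3⟩ := hx (L.σ i e) (by omega)
          exacts [.inl h, .inr ⟨q, by omega, h2, h3⟩]
      exact ⟨z, fun _ => ⟨⟨q, by omega, hq.2⟩, hz⟩⟩
    choose z hz using hstep
    have hold : ∀ e, layer e ≤ l → (if layer e = l + 1 then z e else x e) = x e := fun e he =>
      if_neg (by omega)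
    refine ⟨fun e => if layer e = l + 1 then z e else x e, ?_, ?_, fun e he => ?_, fun e he => ?_⟩
    · exact (hold d (by omega)).trans hxd
    · dsimp only
      rwa [hold c (by omega)]
    · by_cases h : layer e = l + 1
      · simp only [h, if_true]
        exact .inr (by simpa only [h] using (hz e h).1)
      · dsimp only
        rw [hold e (by omega)]
        exact hx e (by omega)
    · by_cases h : layer e = l + 1
      · have hin : ∀ i, layer (L.σ i e) ≤ l := fun i => by
          have := hL.next e (by omega) i
          omega
        simp only [hold _ (hin _), h, if_true]
        exact (hz e h).2
      · have hin : ∀ i, layer (L.σ i e) ≤ l := fun i => by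
          have := hlow e i
          omega
        simp only [hold _ (hin _), h, if_false]
        exact heq e (by omega)

/-- The one-sided branch given by functions of `|t| ^ (2 ^ (-p))` that are smooth near `0`. -/
theorem exists_branch_of_contDiffAt {x : C' → ℝ → ℝ} {δ : ℝ} (hδ : 0 < δ)
    (hx : ∀ s, |s| < δ → ∀ e, ContDiffAt ℝ ∞ (x e) s) (p : ℕ) {ε : ℝ} (hε : ε = 1 ∨ ε = -1) :
    ∃ b : Branch C', (∀ t e, b.toFun t e = x e (|t| ^ ((2 : ℝ) ^ p)⁻¹)) ∧
      (∀ t ∈ b.dom, ∃ s, 0 ≤ s ∧ s < δ ∧ t = ε * s ^ 2 ^ p) ∧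
      ∀ s, 0 ≤ s → s < δ → ε * s ^ 2 ^ p ∈ b.dom := by
  have hp : (2 ^ p : ℕ) ≠ 0 := by positivity
  have hρ : (δ ^ 2 ^ p) ^ ((2 : ℝ) ^ p)⁻¹ = δ := by
    simpa using Real.pow_rpow_inv_natCast hδ.le hp
  have hsm : ∀ e, ContDiffOn ℝ ∞ (x e) (Ico 0 ((δ ^ 2 ^ p) ^ ((2 : ℝ) ^ p)⁻¹)) := fun e s hs => by
    rw [hρ] at hs
    exact (hx s (by rw [abs_of_nonneg hs.1]; exact hs.2) e).contDiffWithinAt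
  have hroot : ∀ t : ℝ, 0 ≤ t → t < δ ^ 2 ^ p → ∃ s, 0 ≤ s ∧ s < δ ∧ t = s ^ 2 ^ p := by
    intro t ht htδ
    have h1 : (t ^ ((2 : ℝ) ^ p)⁻¹) ^ 2 ^ p = t := by
      simpa using Real.rpow_inv_natCast_pow ht hp
    refine ⟨t ^ ((2 : ℝ) ^ p)⁻¹, by positivity, ?_, h1.symm⟩
    rw [← h1] at htδ
    exact lt_of_pow_lt_pow_left₀ _ hδ.le htδ
  obtain rfl | rfl := hε
  · refine ⟨⟨Ico 0 (δ ^ 2 ^ p), fun t e => x e (|t| ^ ((2 : ℝ) ^ p)⁻¹),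
      .inr ⟨_, by positivity, .inl rfl, fun e => ⟨p, x e, hsm e, fun _ _ => rfl⟩⟩⟩,
      fun _ _ => rfl, fun t ht => ?_, fun s h0 hs => ?_⟩
    · simpa using hroot t ht.1 ht.2
    · rw [one_mul]
      exact ⟨by positivity, pow_lt_pow_left₀ hs h0 hp⟩
  · refine ⟨⟨Ioc (-(δ ^ 2 ^ p)) 0, fun t e => x e (|t| ^ ((2 : ℝ) ^ p)⁻¹),
      .inr ⟨_, by positivity, .inr rfl, fun e => ⟨p, x e, hsm e, fun _ _ => rfl⟩⟩⟩,
      fun _ _ => rfl, fun t ht => ?_, fun s h0 hs => ?_⟩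
    · obtain ⟨s, h0, h1, h2⟩ := hroot (-t) (by linarith [ht.2]) (by linarith [ht.1])
      exact ⟨s, h0, h1, by linarith⟩
    · rw [neg_one_mul]
      exact ⟨neg_lt_neg (pow_lt_pow_left₀ hs h0 hp), by
        have : 0 ≤ s ^ 2 ^ p := by positivity
        linarith⟩

open Asymptotics in
theorem exists_equilibriumBranch_separating [Finite C'] {L : Network k C'} {m : ℕ}
    {layer : C' → ℕ} (hL : L.IsFeedForward m layer) {f : Response k} (hf : f ∈ V0gen k)
    (hsign : (∀ i, 0 < dInput f i) ∨ (∀ i, dInput f i < 0)) {j : ℕ} (hj : 0 < j) (hjm : j ≤ m)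
    {c d : C'} (hcd : c ≠ d) (hc : layer c = j) (hd : layer d = j) :
    ∃ b : Branch C', IsEquilibriumBranch L f b ∧
      ¬ (fun t => b.toFun t c - b.toFun t d) =o[𝓝[b.dom] 0] (id : ℝ → ℝ) := by
  have h00 := hf.2.1
  -- `η` is opposite to the common sign of the products `f_i f_{00}`, which makes the square roots
  -- real.
  obtain ⟨η, hη1, hη⟩ : ∃ η : ℝ, η ^ 2 = 1 ∧ ∀ i, η * dInput f i * d00 f < 0 := by
    obtain h | h := hsign <;> obtain h' | h' := h00.lt_or_gt
    · exact ⟨1, by norm_num, fun i => by nlinarith [mul_neg_of_pos_of_neg (h i) h']⟩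
    · exact ⟨-1, by norm_num, fun i => by nlinarith [mul_pos (h i) h']⟩
    · exact ⟨-1, by norm_num, fun i => by nlinarith [mul_pos_of_neg_of_neg (h i) h']⟩
    · exact ⟨1, by norm_num, fun i => by nlinarith [mul_neg_of_neg_of_pos (h i) h']⟩
  have hη0 : η ≠ 0 := by
    rintro rfl
    norm_num at hη1
  obtain ⟨ε, hε1, hε⟩ : ∃ ε : ℝ, (ε = 1 ∨ ε = -1) ∧ ε * d0par f * d00 f * η < 0 := by
    obtain h | h := (mul_ne_zero (mul_ne_zero hf.2.2 h00) hη0).lt_or_gt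
    · exact ⟨1, .inl rfl, by linarith⟩
    · exact ⟨-1, .inr rfl, by linarith⟩
  obtain ⟨x, hxd, hxc, hx, heq⟩ :=
    exists_layerwise_solution hL hf hη1 hη hε hj hcd hc hd m hjm le_rfl
  have hev : ∀ᶠ s in 𝓝 (0 : ℝ), (∀ e, ContDiffAt ℝ ∞ (x e) s) ∧
      ∀ e, f (x e s, fun i => x (L.σ i e) s, ε * s ^ 2 ^ m) = 0 := by
    refine (eventually_all.2 fun e => ?_).and (eventually_all.2 fun e => heq e (hL.layer_le e))
    obtain h | ⟨q, -, -, h⟩ := hx e (hL.layer_le e)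
    · rw [h]
      exact Eventually.of_forall fun s => contDiffAt_const
    · exact h.eventually_contDiffAt
  obtain ⟨δ, hδ, hball⟩ := Metric.eventually_nhds_iff.1 hev
  simp only [Real.dist_eq, sub_zero] at hball
  obtain ⟨b, hb, hdom, hdom'⟩ := exists_branch_of_contDiffAt hδ (fun s hs => (hball hs).1) m hε1
  have hp : (2 ^ m : ℕ) ≠ 0 := by positivity
  have habs : ∀ s : ℝ, 0 ≤ s → |ε * s ^ 2 ^ m| = s ^ 2 ^ m := fun s hs => by
    have : |ε| = 1 := by obtain rfl | rfl := hε1 <;> simp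
    rw [abs_mul, this, one_mul, abs_of_nonneg (by positivity)]
  have hb' : ∀ s, 0 ≤ s → ∀ e, b.toFun (ε * s ^ 2 ^ m) e = x e s := fun s hs e => by
    have h1 : (s ^ 2 ^ m) ^ ((2 : ℝ) ^ m)⁻¹ = s := by
      simpa using Real.pow_rpow_inv_natCast hs hp
    rw [hb, habs s hs, h1]
  refine ⟨b, ⟨?_, fun t ht => ?_⟩, fun ho => ?_⟩
  · funext e
    have h1 := hb' 0 le_rfl e
    rw [zero_pow hp, mul_zero] at h1
    rw [h1]
    obtain h | ⟨q, -, -, u, -, -, h⟩ := hx e (hL.layer_le e)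
    · rw [h]; rfl
    · rw [h]
      simp
  · obtain ⟨s, h0, hs, rfl⟩ := hdom t ht
    funext e
    simp only [Network.vectorField, hb' s h0]
    exact (hball (by rwa [abs_of_nonneg h0])).2 e
  · obtain ⟨u, hus, hu0, hxu⟩ := hxc
    have hune : u 0 ≠ 0 := by
      intro h
      simp [h] at hu0
    have ht : Tendsto (fun s : ℝ => ε * s ^ 2 ^ m) (𝓝[>] 0) (𝓝[b.dom] 0) := by
      refine tendsto_nhdsWithin_iff.2 ⟨?_, ?_⟩
      · exact ((by fun_prop : Continuous fun s : ℝ => ε * s ^ 2 ^ m).tendsto' 0 0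
          (by simp)).mono_left nhdsWithin_le_nhds
      · filter_upwards [Ioo_mem_nhdsGT hδ] with s hs using hdom' s hs.1.le hs.2
    -- Along `λ = ε s ^ 2 ^ m` the difference is `u s * s ^ 2 ^ m` with `u 0 ≠ 0`, so the bound with
    -- constant `|u 0| / 2` fails.
    have h1 := ht.eventually (ho.def (half_pos (abs_pos.2 hune)))
    have h2 : ∀ᶠ s in 𝓝[>] (0 : ℝ), |u 0| / 2 < |u s| :=
      nhdsWithin_le_nhds (hus.self_of_nhds.continuousAt.abs.eventually
        (lt_mem_nhds (half_lt_self (abs_pos.2 hune))))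
    obtain ⟨s, ⟨h3, h4⟩, hs⟩ := ((h1.and h2).and self_mem_nhdsWithin).exists
    have hs0 : (0 : ℝ) < s := hs
    have hpos : 0 < s ^ 2 ^ m := by positivity
    simp only [hb' s hs0.le, hxd, hxu, Pi.zero_apply, sub_zero, Real.norm_eq_abs, id,
      habs s hs0.le] at h3
    rw [abs_mul, abs_of_pos hpos, mul_comm] at h3
    exact absurd (le_of_mul_le_mul_right h3 hpos) (not_le.2 h4)

end FeedForward

theorem mainTheorem10 {k : ℕ} {C C' : Type*} [Finite C] [Finite C']
    (N : Network k C) (m : ℕ) (layer : C → ℕ) (hN : N.IsFeedForward m layer)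
    (L : Network k C') (n : ℕ) (layer' : C' → ℕ) (hL : L.IsFeedForward n layer')
    (hback : L.BackwardConnected)
    (j : ℕ) (hj : 0 < j) (hjm : j + 1 < m)
    (hlift : N.IsLiftInsideLayer m layer L n layer' j) :
    FeedForward.OpenDenseIn (FeedForward.V0 k) (FeedForward.V0gen k) ∧
    ∀ f ∈ FeedForward.V0gen k,
      ((∀ i, 0 < FeedForward.dInput f i) ∨ (∀ i, FeedForward.dInput f i < 0)) →
      ∃ b : FeedForward.Branch C',
        FeedForward.IsBifurcationBranch L f b ∧ ¬ FeedForward.IsLiftedFrom N L b := by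
  refine ⟨FeedForward.openDenseIn_V0gen k, fun f hf hsign => ?_⟩
  obtain ⟨c, d, hcd, hc, hd, h⟩ :=
    hN.exists_ne_forall_isQuotientBy hL hback (by omega) hlift
  obtain ⟨b, hb, hsep⟩ := FeedForward.exists_equilibriumBranch_separating hL hf hsign hj
    (by have := hlift.length_eq; omega) hcd hc hd
  exact ⟨b, ⟨hb, FeedForward.not_germEquiv_trivial hsep⟩, FeedForward.not_isLiftedFrom h hsep⟩
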